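/- Let $M$ be a matroid of rank $r$ on a finite set $E$ with $n$ elements, with independent sets $\mathcal I(M)$, and fix a linear order $<$ on $E$. For $S\subseteq E$, an element $e\in E\setminus S$ is externally active with respect to $S$ if it is the maximum of some circuit contained in $S\cup e$, and externally passive otherwise; $\operatorname{EA}(S)$ and $\operatorname{EP}(S)$ are the sets of such elements. An element $i \in S$ is internally active with respect to $S$ if it is externally active with respect to $E\setminus S$ in the dual matroid, and internally passive otherwise; $\operatorname{IA}(S)$ and $\operatorname{IP}(S)$ are the sets of such elements. Every independent set $I$ can be written uniquely as $I=A\setminus Y_I$ with $A$ a basis and $Y_I\subseteq \operatorname{IA}(A)$; we say that $I$ is related to $A$. The augmented external activity complex $\Delta_M$ is the simplicial complex on the vertices $x_e,y_e,z_e$ ($e\in E$) with facets \[F(I)=x_{I\cup \operatorname{EP}(I)}\,y_{Y_I}\,z_{I\cup \operatorname{EA}(I)},\qquad I\in\mathcal I(M),\] where $x_S y_U z_T=\{x_e:e\in S\}\cup\{y_e:e\in U\}\cup\{z_e:e\in T\}$. For bases $A,B$ let $A\le_{ext/int}B$ mean $\operatorname{IP}(A)\cap \operatorname{EP}(B)=\emptyset$.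 For $I,J\in\mathcal I(M)$ related to bases $A,B$ let $I\le'_{ext/int}J$ mean that either $A\ne B$ and $A\le_{ext/int}B$, or $A=B$ and $J\subseteq I$. The restriction set of a facet $F_k$ in a shelling order is the set $R_k\subseteq F_k$ such that a subset $G\subseteq F_k$ contains $R_k$ if and only if $G$ is contained in no earlier facet. Let $\prec'$ be any linear extension of $\le'_{ext/int}$ on $\mathcal I(M)$. Then the corresponding ordering of the facets $F(I)$ is a shelling order of the pure complex $\Delta_M$, and for each independent set $I=A\setminus Y_I$ related to the basis $A$ the restriction set of $F(I)$ is $y_{Y_I}z_{\operatorname{IP}(A)}$. Consequently the bivariate $h$-polynomial of $\Delta_M$, namely the sum over all facets of $q^{-a}t^{\,n+r-b}$, where $a$ and $b$ are the numbers of $y$- and of $z$-vertices in the restriction set of the facet, equals \[\sum_{I\in\mathcal I(M)}q^{-|Y_I|}\,t^{\,n+r-|\operatorname{IP}(I)|}=t^n\,T_M\bigl((1/q+1)t,\,1\bigr),\] an identity of Laurent polynomials in $q,t$ over $\mathbb Z$, where $T_M(x,y)=\sum_{S\subseteq E}(x-1)^{r-\operatorname{rk}(S)}(y-1)^{|S|-\operatorname{rk}(S)}$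 is the Tutte polynomial of $M$ and $\operatorname{rk}$ is its rank function. -/

import Mathlib

namespace AugExt

open Set

section Activities

variable {α : Type*} [LinearOrder α]

/-- Elements of the ground set outside `S` that are the maximum of a circuit in `S ∪ e`. -/
def EA (M : Matroid α) (S : Set α) : Set α :=
  {e | e ∈ M.E \ S ∧ ∃ C, M.IsCircuit C ∧ C ⊆ insert e S ∧ IsGreatest C e}

/-- Externally passive elements. -/
def EP (M : Matroid α) (S : Set α) : Set α := (M.E \ S) \ EA M S

/-- Internally active elements: those elements of `S` that are externally active with respect to
the complement of `S` in the dual matroid. -/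
def IA (M : Matroid α) (S : Set α) : Set α := {i | i ∈ S ∧ i ∈ EA M✶ (M.E \ S)}

/-- Internally passive elements. -/
def IP (M : Matroid α) (S : Set α) : Set α := S \ IA M S

/-- `I` is obtained from the basis `B` by deleting internally active elements. -/
def RelatedTo (M : Matroid α) (I B : Set α) : Prop :=
  M.IsBase B ∧ ∃ Y, Y ⊆ IA M B ∧ I = B \ Y

theorem exists_relatedTo (M : Matroid α) [M.Finite] {I : Set α} (hI : M.Indep I) :
    ∃ B, RelatedTo M I B := by
  induction hn : (M.E \ I).ncard using Nat.strong_induction_on generalizing I with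
  | _ n ih =>
    by_cases hb : M.IsBase I
    · exact ⟨I, hb, ∅, empty_subset _, by simp⟩
    have hne : (M.E \ M.closure I).Nonempty := by
      rw [nonempty_iff_ne_empty]
      intro h
      refine hb (hI.isBase_of_ground_subset_closure ?_)
      exact sdiff_eq_empty.mp h
    have hfin : (M.E \ M.closure I).Finite := M.ground_finite.subset sdiff_subset
    obtain ⟨c, hc, hmax⟩ := hfin.exists_maximal hne
    have hcI : c ∉ I := fun h => hc.2 (M.subset_closure I hI.subset_ground h)
    have hIc : M.Indep (insert c I) := (hI.notMem_closure_iff_of_notMem hcI hc.1).mp hc.2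
    have hlt : (M.E \ insert c I).ncard < n := by
      rw [← hn]
      refine ncard_lt_ncard ?_ (M.ground_finite.subset sdiff_subset)
      refine ⟨sdiff_subset_sdiff_right (subset_insert _ _), fun h => ?_⟩
      exact (h ⟨hc.1, hcI⟩).2 (mem_insert _ _)
    obtain ⟨B, hB, Y, hY, hYI⟩ := ih _ hlt hIc rfl
    have hcB : c ∈ B \ Y := hYI ▸ mem_insert c I
    refine ⟨B, hB, insert c Y, insert_subset ?_ hY, ?_⟩
    · refine ⟨hcB.1, ⟨hc.1, fun h => h.2 hcB.1⟩, M.E \ M.closure (B \ {c}),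
        (hB.compl_closure_sdiff_singleton_isCocircuit hcB.1).isCircuit, ?_, ?_, ?_⟩
      · intro f hf
        by_cases hfc : f = c
        · exact Or.inl hfc
        · exact Or.inr ⟨hf.1, fun hfB => hf.2 (M.subset_closure (B \ {c})
            (sdiff_subset.trans hB.subset_ground) ⟨hfB, hfc⟩)⟩
      · exact ⟨hc.1, hB.indep.notMem_closure_sdiff_of_mem hcB.1⟩
      · intro f hf
        have hf' : f ∈ M.E \ M.closure I := by
          refine ⟨hf.1, fun h => hf.2 (M.closure_subset_closure ?_ h)⟩
          intro x hx
          have hx' : x ∈ B \ Y := hYI ▸ mem_insert_of_mem c hx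
          exact ⟨hx'.1, fun h => hcI (h ▸ hx)⟩
        rcases le_total f c with h | h
        · exact h
        · exact hmax hf' h
    · ext x
      have := Set.ext_iff.mp hYI x
      simp only [mem_insert_iff, mem_sdiff] at this ⊢
      constructor
      · intro hx
        have hxc : x ≠ c := fun h => hcI (h ▸ hx)
        tauto
      · tauto

theorem smaller_of_mem {M : Matroid α} {I B B' : Set α} (h : RelatedTo M I B)
    (h' : RelatedTo M I B') {c : α} (hc : c ∈ B \ B') : ∃ f ∈ B' \ B, f < c := by
  obtain ⟨-, Y, hY, rfl⟩ := h
  obtain ⟨hB', Y', -, hI⟩ := h'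
  have hcY : c ∈ Y := by
    by_contra hcY
    have : c ∈ B' \ Y' := hI ▸ ⟨hc.1, hcY⟩
    exact hc.2 this.1
  obtain ⟨-, -, K, hK, hKs, -, hKc⟩ := hY hcY
  have hmeet : (K ∩ B').Nonempty := by
    by_contra hd
    have hKE : K ⊆ M.E \ B' := fun x hx =>
      ⟨hK.subset_ground hx, fun hxB => hd ⟨x, hx, hxB⟩⟩
    exact hK.not_indep (hB'.compl_isBase_dual.indep.subset hKE)
  obtain ⟨f, hfK, hfB'⟩ := hmeet
  have hfc : f ≠ c := fun h => hc.2 (h ▸ hfB')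
  rcases hKs hfK with h | h
  · exact absurd h hfc
  · exact ⟨f, ⟨hfB', h.2⟩, lt_of_le_of_ne (hKc hfK) hfc⟩

theorem relatedTo_unique (M : Matroid α) [M.Finite] {I B B' : Set α} (h : RelatedTo M I B)
    (h' : RelatedTo M I B') : B = B' := by
  by_contra hne
  have hfin : ((B \ B') ∪ (B' \ B)).Finite :=
    M.ground_finite.subset (union_subset (sdiff_subset.trans h.1.subset_ground)
      (sdiff_subset.trans h'.1.subset_ground))
  have hnon : ((B \ B') ∪ (B' \ B)).Nonempty := by
    rw [nonempty_iff_ne_empty]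
    intro he
    rw [union_empty_iff, sdiff_eq_empty, sdiff_eq_empty] at he
    exact hne (he.1.antisymm he.2)
  obtain ⟨m, hm, hmin⟩ := hfin.exists_minimal hnon
  rcases hm with hm | hm
  · obtain ⟨f, hf, hlt⟩ := smaller_of_mem h h' hm
    exact absurd (hmin (Or.inr hf) hlt.le) (not_le.mpr hlt)
  · obtain ⟨f, hf, hlt⟩ := smaller_of_mem h' h hm
    exact absurd (hmin (Or.inl hf) hlt.le) (not_le.mpr hlt)

/-- The independent sets of `M`. -/
abbrev IndepSet (M : Matroid α) : Type _ := {I : Set α // M.Indep I}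

instance indepSetFinite (M : Matroid α) [M.Finite] : Finite (IndepSet M) :=
  (M.ground_finite.finite_subsets.subset fun _ hI => hI.subset_ground :
    {I : Set α | M.Indep I}.Finite).to_subtype

/-- The unique basis to which the independent set `I` is related. -/
noncomputable def relatedBase (M : Matroid α) [M.Finite] (I : IndepSet M) : Set α :=
  (exists_relatedTo M I.2).choose

/-- The set `Y_I` of internally active elements with `I = B \ Y_I`. -/
noncomputable def removed (M : Matroid α) [M.Finite] (I : IndepSet M) : Set α :=
  relatedBase M I \ I

/-- Las Vergnas's external/internal order on bases. -/
def ExtIntLE (M : Matroid α) (A B : Set α) : Prop := IP M A ∩ EP M B = ∅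

/-- The flipped external/internal order on independent sets. -/
def FlippedLE (M : Matroid α) [M.Finite] (I J : IndepSet M) : Prop :=
  (relatedBase M I ≠ relatedBase M J ∧ ExtIntLE M (relatedBase M I) (relatedBase M J)) ∨
  (relatedBase M I = relatedBase M J ∧ (J : Set α) ⊆ I)

end Activities

section Shellings

variable {ι V : Type*}

/-- `r` (read as `≼`) is a linear order containing the relation `le`. -/
structure IsLinearExtension (le r : ι → ι → Prop) : Prop where
  isLinearOrder : IsLinearOrder ι r
  extend : ∀ a b, le a b → r a b

/-- The facets (maximal faces) of a simplicial complex, given as the set of its faces. -/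
def facets (Δ : Set (Set V)) : Set (Set V) := {G | Maximal (· ∈ Δ) G}

/-- `F` lists the facets of the pure complex `Δ` without repetition, and the linear order `r` on
the indices is a shelling order. -/
structure IsShellingOrder (Δ : Set (Set V)) (F : ι → Set V) (r : ι → ι → Prop) : Prop where
  isLinearOrder : IsLinearOrder ι r
  injective : Function.Injective F
  range_eq : Set.range F = facets Δ
  pure : ∀ i j, (F i).encard = (F j).encard
  shell : ∀ i k, r i k → i ≠ k → ∃ j, r j k ∧ j ≠ k ∧ ∃ e ∈ F k,
    F i ∩ F k ⊆ F j ∩ F k ∧ F j ∩ F k = F k \ {e}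

/-- `R` is the restriction set of the facet `F k`: a face of `F k` is new (contained in no
earlier facet) exactly when it contains `R`. -/
def IsRestrictionSet (F : ι → Set V) (r : ι → ι → Prop) (k : ι) (R : Set V) : Prop :=
  R ⊆ F k ∧ ∀ A, A ⊆ F k → (R ⊆ A ↔ ∀ i, r i k → i ≠ k → ¬ A ⊆ F i)

end Shellings

section Complex

variable {α : Type*}

/-- The vertices `x_e`, `y_e`, `z_e`. -/
inductive Vertex (α : Type*) : Type _
  | x (e : α) : Vertex α
  | y (e : α) : Vertex α
  | z (e : α) : Vertex α

/-- The set `x_S y_U z_T`. -/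
def xyz (S U T : Set α) : Set (Vertex α) := Vertex.x '' S ∪ Vertex.y '' U ∪ Vertex.z '' T

def suppY (G : Set (Vertex α)) : Set α := {e | Vertex.y e ∈ G}

def suppZ (G : Set (Vertex α)) : Set α := {e | Vertex.z e ∈ G}

variable [LinearOrder α]

/-- The facet `F(I)`. -/
noncomputable def augFacet (M : Matroid α) [M.Finite] (I : IndepSet M) : Set (Vertex α) :=
  xyz (I ∪ EP M I) (removed M I) (I ∪ EA M I)

/-- The augmented external activity complex, as the set of its faces. -/
def augComplex (M : Matroid α) [M.Finite] : Set (Set (Vertex α)) :=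
  {G | ∃ I : IndepSet M, G ⊆ augFacet M I}

end Complex

section Polynomials

/-- Laurent polynomials over `ℤ` in two variables `t` (inner) and `q` (outer). -/
abbrev Laurent2 : Type := LaurentPolynomial (LaurentPolynomial ℤ)

/-- The monomial `q ^ a`. -/
noncomputable def qPow (a : ℤ) : Laurent2 := LaurentPolynomial.T a

/-- The monomial `t ^ b`. -/
noncomputable def tPow (b : ℤ) : Laurent2 := LaurentPolynomial.C (LaurentPolynomial.T b)

/-- The rank `r` of the matroid. -/
noncomputable def rank {α : Type*} (M : Matroid α) : ℕ := M.eRank.toNat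

/-- The rank of a subset. -/
noncomputable def rk {α : Type*} (M : Matroid α) (S : Set α) : ℕ := (M.eRk S).toNat

/-- The Tutte polynomial (corank-nullity expansion), in the variables `X 0` and `X 1`. -/
noncomputable def tutte {α : Type*} (M : Matroid α) [M.Finite] : MvPolynomial (Fin 2) ℤ :=
  ∑ S ∈ M.ground_finite.toFinset.powerset,
    (MvPolynomial.X 0 - 1) ^ (rank M - rk M (S : Set α)) *
      (MvPolynomial.X 1 - 1) ^ (S.card - rk M (S : Set α))

/-- The evaluation `T_M(a, b)`. -/
noncomputable def tutteEval {α : Type*} (M : Matroid α) [M.Finite] (a b : Laurent2) : Laurent2 :=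
  MvPolynomial.aeval ![a, b] (tutte M)

/-- The bivariate `h`-polynomial attached to the restriction sets `R i` of a shelling whose
facets have `d` elements: `q` records the `y`-vertices and `t` the `z`-vertices. When no `R i`
contains an `x`-vertex, putting `q = t` gives the ordinary `∑ i, t ^ (d - |R i|)`. -/
noncomputable def bivariateH {α ι : Type*} (d : ℕ) (R : ι → Set (Vertex α)) : Laurent2 :=
  ∑ᶠ i, qPow (-((suppY (R i)).ncard : ℤ)) * tPow ((d : ℤ) - ((suppZ (R i)).ncard : ℤ))

end Polynomials

end AugExt

/-! The shelling follows from a criterion independent of matroids. Suppose each facet `F k` has a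
candidate `R k ⊆ F k` such that every `v ∈ R k` can be traded for an earlier facet that contains `F
k \ {v}` and misses `v`, and `R k ⊆ F i` forces `k ≼ i`. Then the order is a shelling with
restriction sets `R k`.

For `R = y_{Y_I} z_{IP(A)}` the second condition comes directly from the definition of the flipped
order. For the first, a vertex `y_e` is removed by putting `e` back into `I`. A vertex `z_e` with `e
∈ IP(A)` needs a basis exchange, and this is the heart of the proof (`exists_exchange_of_mem_IP`):
some `f` makes `B = A - e + f` an earlier basis with `EA(B) = EA(A) \ {f}` and `IA(A) ⊆ IA(B)`, so
that the same `Y` still works over `B`.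

For the polynomial identity, group the independent sets by related basis: the subsets of `IA(B)`
contribute `(u + 1)^|IA(B)|`. Taking `u = 1/q` on one side and `u = (1/q + 1)t - 1` in `T_M(x, 1) =
∑ (x - 1)^(r - |I|)` on the other turns both sides into the same sum over bases. -/

namespace AugExt

open Set

/-! ### Closures under a basis exchange -/

section Exchange

variable {α : Type*} {M : Matroid α} {A : Set α} {a e f g : α}

theorem notMem_of_notMem_closure_sdiff_singleton (hA : M.IsBase A)
    (hf : f ∉ M.closure (A \ {e})) (hfe : f ≠ e) : f ∉ A := fun h =>
  hf (M.subset_closure (A \ {e}) (sdiff_subset.trans hA.subset_ground) ⟨h, hfe⟩)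

theorem isBase_exchange_of_notMem_closure (hA : M.IsBase A) (hf : f ∈ M.E)
    (hfe : f ≠ e) (hfcl : f ∉ M.closure (A \ {e})) : M.IsBase (insert f (A \ {e})) := by
  have hfA := notMem_of_notMem_closure_sdiff_singleton hA hfcl hfe
  refine hA.exchange_isBase_of_indep hfA ?_
  exact ((hA.indep.subset sdiff_subset).notMem_closure_iff_of_notMem
      (fun h => hfA h.1) hf).mp hfcl

/-- If `a`, `g` are an exchange pair of the basis `A - e + f`, then they are one of `A`,
or both `a, f` and `e, g` are. -/
theorem notMem_closure_of_exchange (hA : M.IsBase A) (he : e ∈ A)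
    (hfe : f ≠ e) (hfcl : f ∉ M.closure (A \ {e})) (ha : a ∈ A) (hae : a ≠ e)
    (hg : g ∉ M.closure (insert f (A \ {e}) \ {a})) :
    g ∉ M.closure (A \ {a}) ∨ f ∉ M.closure (A \ {a}) ∧ g ∉ M.closure (A \ {e}) := by
  have haf : f ≠ a := fun h => notMem_of_notMem_closure_sdiff_singleton hA hfcl hfe (h ▸ ha)
  have hset : insert f (A \ {e}) \ {a} = insert f ((A \ {a}) \ {e}) := by
    rw [← insert_sdiff_singleton_comm haf, sdiff_sdiff_comm]
  rw [hset] at hg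
  by_contra! hcon
  obtain ⟨hga, hcon⟩ := hcon
  have hinter : M.closure (A \ {a} ∩ (A \ {e})) = M.closure (A \ {a}) ∩ M.closure (A \ {e}) :=
    (hA.indep.subset (union_subset sdiff_subset sdiff_subset)).closure_inter_eq_inter_closure
  have hD : A \ {a} ∩ (A \ {e}) = (A \ {a}) \ {e} := by ext; simp; tauto
  rw [hD] at hinter
  have hsub : M.closure ((A \ {a}) \ {e}) ⊆ M.closure (insert f ((A \ {a}) \ {e})) :=
    M.closure_subset_closure (subset_insert _ _)
  have hge : g ∉ M.closure (A \ {e}) := fun h => hg (hsub (hinter ▸ ⟨hga, h⟩))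
  have hfa : f ∈ M.closure (A \ {a}) := by
    by_contra h
    exact hge (hcon h)
  have hins : insert e ((A \ {a}) \ {e}) = A \ {a} := insert_sdiff_self_of_mem ⟨he, hae.symm⟩
  refine hg ?_
  -- Over `A - a - e`, the elements `e` and `f` span the same flat: `f` lies in the closure of `A -
  -- a` but not in that of `A - a - e`. So the closure of `A - e + f - a` is that of `A - a`, which
  -- contains `g`.
  rw [M.closure_insert_congr (e := f) (f := e) ⟨by rwa [hins], fun h => ?_⟩, hins]
  · exact hga
  · rw [hinter] at h
    exact hfcl h.2

end Exchange

/-! ### Activities of bases and of the independent sets related to them -/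

section Activities

variable {α : Type*} [LinearOrder α] {M : Matroid α} {A B Y : Set α} {a e f g : α}

/-- The only circuit in `A + g` is the fundamental one, and `g ∉ M.closure (A \ {a})` says that `a`
belongs to it. All exchange arguments below use this form. -/
theorem mem_EA_iff_of_isBase (hA : M.IsBase A) :
    g ∈ EA M A ↔ g ∈ M.E \ A ∧ ∀ a ∈ A, g ∉ M.closure (A \ {a}) → a < g := by
  constructor
  · rintro ⟨hg, C, hC, hCA, hgC, hmax⟩
    refine ⟨hg, fun a ha hag => lt_of_le_of_ne (hmax ?_) fun h => hg.2 (h ▸ ha)⟩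
    by_contra haC
    refine hag (M.closure_subset_closure ?_ (hC.mem_closure_sdiff_singleton_of_mem hgC))
    rintro x ⟨hxC, hxg⟩
    exact ⟨(hCA hxC).resolve_left hxg, fun h => haC (h ▸ hxC)⟩
  · rintro ⟨hg, h⟩
    refine ⟨hg, M.fundCircuit g A, hA.fundCircuit_isCircuit hg.1 hg.2,
      M.fundCircuit_subset_insert g A, M.mem_fundCircuit g A, fun x hx => ?_⟩
    rcases M.fundCircuit_subset_insert g A hx with rfl | hxA
    · exact le_rfl
    refine (h x hxA ?_).le
    have hgx : g ≠ x := fun h => hg.2 (h ▸ hxA)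
    rw [hA.indep.mem_fundCircuit_iff (by rw [hA.closure_eq]; exact hg.1) hg.2,
      ← insert_sdiff_singleton_comm hgx] at hx
    exact ((hA.indep.subset sdiff_subset).notMem_closure_iff_of_notMem
      (fun h => hg.2 h.1) hg.1).mpr hx

theorem compl_closure_sdiff_singleton_subset (hA : M.IsBase A) :
    M.E \ M.closure (A \ {a}) ⊆ insert a (M.E \ A) := by
  rintro x ⟨hxE, hx⟩
  by_cases hxa : x = a
  · exact Or.inl hxa
  · exact Or.inr ⟨hxE, fun hxA => hx (M.subset_closure (A \ {a})
      (sdiff_subset.trans hA.subset_ground) ⟨hxA, hxa⟩)⟩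

/-- Dually, the complement of `M.closure (A \ {e})` is the fundamental cocircuit of `e`, the only
cocircuit inside `e ∪ (E \ A)`. -/
theorem mem_IA_iff_of_isBase (hA : M.IsBase A) :
    e ∈ IA M A ↔ e ∈ A ∧ ∀ g ∈ M.E, g ∉ M.closure (A \ {e}) → g ≤ e := by
  constructor
  · rintro ⟨heA, -, K, hK, hKA, -, hmax⟩
    refine ⟨heA, fun g hg hgA => hmax ?_⟩
    have hind := hA.compl_isBase_dual.indep
    rw [hK.eq_fundCircuit_of_subset hind hKA,
      ← (hA.compl_closure_sdiff_singleton_isCocircuit heA).isCircuit.eq_fundCircuit_of_subset hind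
        (compl_closure_sdiff_singleton_subset hA)]
    exact ⟨hg, hgA⟩
  · rintro ⟨heA, h⟩
    exact ⟨heA, ⟨hA.subset_ground heA, fun h => h.2 heA⟩, _,
      (hA.compl_closure_sdiff_singleton_isCocircuit heA).isCircuit,
      compl_closure_sdiff_singleton_subset hA,
      ⟨hA.subset_ground heA, hA.indep.notMem_closure_sdiff_of_mem heA⟩, fun g hg => h g hg.1 hg.2⟩

/-- The fundamental circuit of an externally active `g` avoids `IA(A)`: an internally active `x` on
it would satisfy both `x < g` and `g ≤ x`. -/
theorem EA_sdiff_of_subset_IA (hA : M.IsBase A) (hY : Y ⊆ IA M A) : EA M (A \ Y) = EA M A := by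
  ext g
  constructor
  · rintro ⟨hg, C, hC, hCA, hgC⟩
    refine ⟨⟨hg.1, fun hgA => hC.not_indep (hA.indep.subset fun x hx => ?_)⟩, C, hC,
      hCA.trans (insert_subset_insert sdiff_subset), hgC⟩
    rcases hCA hx with rfl | h
    exacts [hgA, h.1]
  · intro hg
    have hg' := (mem_EA_iff_of_isBase hA).mp hg
    obtain ⟨hgE, C, hC, hCA, hgC⟩ := hg
    refine ⟨⟨hgE.1, fun h => hgE.2 h.1⟩, C, hC, fun x hx => ?_, hgC⟩
    by_cases hxg : x = g
    · exact Or.inl hxg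
    refine Or.inr ⟨(hCA hx).resolve_left hxg, fun hxY => ?_⟩
    have hx' := (mem_IA_iff_of_isBase hA).mp (hY hxY)
    have hxcl : g ∉ M.closure (A \ {x}) := by
      intro hcl
      obtain ⟨D, hDs, hD, hgD⟩ := M.exists_isCircuit_of_mem_closure hcl fun h => hgE.2 h.1
      rw [hC.eq_fundCircuit_of_subset hA.indep hCA, ← hD.eq_fundCircuit_of_subset hA.indep
        (hDs.trans (insert_subset_insert sdiff_subset))] at hx
      exact ((hDs hx).resolve_left hxg).2 rfl
    exact absurd (hx'.2 g hgE.1 hxcl) (not_le.mpr (hg'.2 x hx'.1 hxcl))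

theorem EP_sdiff_of_subset_IA (hA : M.IsBase A) (hY : Y ⊆ IA M A) :
    EP M (A \ Y) = EP M A ∪ Y := by
  ext g
  have hYE : g ∈ Y → g ∈ M.E ∧ g ∈ A := fun h => ⟨hA.subset_ground (hY h).1, (hY h).1⟩
  have hEA : g ∈ EA M A → g ∉ A := fun h => h.1.2
  simp only [EP, EA_sdiff_of_subset_IA hA hY, mem_sdiff, mem_union]
  tauto

theorem IP_sdiff_of_subset_IA (hA : M.IsBase A) (hY : Y ⊆ IA M A) :
    IP M (A \ Y) = IP M A := by
  ext e
  constructor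
  · rintro ⟨he, hea⟩
    refine ⟨he.1, fun heA => hea ⟨he, ?_⟩⟩
    obtain ⟨-, ⟨heE, -⟩, K, hK, hKA, hKe⟩ := heA
    exact ⟨⟨heE, fun h => h.2 he⟩, K, hK,
      hKA.trans (insert_subset_insert (sdiff_subset_sdiff_right sdiff_subset)), hKe⟩
  · rintro ⟨heA, hea⟩
    refine ⟨⟨heA, fun h => hea (hY h)⟩, fun hact => hea ?_⟩
    obtain ⟨-, -, K, hK, hKs, heK, hKe⟩ := hact
    refine (mem_IA_iff_of_isBase hA).mpr ⟨heA, fun g hg hgcl => ?_⟩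
    by_contra! hlt
    have hgA : g ∉ A := fun h => hgcl (M.subset_closure (A \ {e})
      (sdiff_subset.trans hA.subset_ground) ⟨h, hlt.ne'⟩)
    have hmem : ∀ x ∈ A, x ∈ M.fundCircuit g A ↔ g ∉ M.closure (A \ {x}) := fun x hxA => by
      have hgx : g ≠ x := fun h => hgA (h ▸ hxA)
      rw [hA.indep.mem_fundCircuit_iff (by rw [hA.closure_eq]; exact hg) hgA,
        ← insert_sdiff_singleton_comm hgx,
        (hA.indep.subset sdiff_subset).notMem_closure_iff_of_notMem (fun h => hgA h.1) hg]
    -- The fundamental circuit of `g` would meet `K` in `e` alone, which is impossible. Another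
    -- common element `x` is not `g`, so it lies in `Y`, and its internal activity gives `g ≤ x ≤
    -- e`.
    refine (hA.fundCircuit_isCircuit hg hgA).inter_isCocircuit_ne_singleton (K := K) (e := e) hK ?_
    ext x
    simp only [mem_inter_iff, mem_singleton_iff]
    refine ⟨fun ⟨hxC, hxK⟩ => ?_, ?_⟩
    · by_contra hxe
      have hxg : x ≠ g := fun h => absurd (hKe hxK) (not_le.mpr (h ▸ hlt))
      have hxA := (M.fundCircuit_subset_insert g A hxC).resolve_left hxg
      have hxY : x ∈ Y := by
        by_contra hxY
        exact ((hKs hxK).resolve_left hxe).2 ⟨hxA, hxY⟩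
      exact absurd ((((mem_IA_iff_of_isBase hA).mp (hY hxY)).2 g hg ((hmem x hxA).mp hxC)).trans
        (hKe hxK)) (not_le.mpr hlt)
    · rintro rfl
      exact ⟨(hmem x heA).mpr hgcl, heK⟩

theorem union_EP_eq (hA : M.IsBase A) : A ∪ EP M A = M.E \ EA M A := by
  ext e
  have hAE : e ∈ A → e ∈ M.E := fun h => hA.subset_ground h
  have hEA : e ∈ EA M A → e ∉ A := fun h => h.1.2
  simp only [EP, mem_union, mem_sdiff]
  tauto

/-- An internally passive element `e` of a basis can be exchanged for an element `f` so that `f` is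
the only element that stops being externally active. -/
theorem exists_exchange_of_mem_IP [M.Finite] (hA : M.IsBase A) (he : e ∈ IP M A) :
    ∃ f ∉ A, M.IsBase (insert f (A \ {e})) ∧ EA M (insert f (A \ {e})) = EA M A \ {f} ∧
      IA M A ⊆ IA M (insert f (A \ {e})) ∧ ExtIntLE M (insert f (A \ {e})) A := by
  obtain ⟨heA, hep⟩ := he
  -- The choice of `f` in the fundamental cocircuit of `e`: its least externally active element if
  -- there is one, otherwise its maximum, which exceeds `e` because `e` is internally passive.
  obtain ⟨f, hfE, hfcl, hef, hf⟩ : ∃ f ∈ M.E, f ∉ M.closure (A \ {e}) ∧ e < f ∧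
      ((f ∈ EA M A ∧ ∀ g ∈ EA M A, g ∉ M.closure (A \ {e}) → f ≤ g) ∨
        ((∀ g ∈ EA M A, g ∈ M.closure (A \ {e})) ∧
          ∀ g ∈ M.E, g ∉ M.closure (A \ {e}) → g ≤ f)) := by
    by_cases hne : (EA M A \ M.closure (A \ {e})).Nonempty
    · have hfin : (EA M A \ M.closure (A \ {e})).Finite :=
        M.ground_finite.subset fun x hx => hx.1.1.1
      obtain ⟨f, hf, hmin⟩ := hfin.exists_minimal hne
      refine ⟨f, hf.1.1.1, hf.2, ((mem_EA_iff_of_isBase hA).mp hf.1).2 e heA hf.2,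
        Or.inl ⟨hf.1, fun g hg hgcl => ?_⟩⟩
      rcases le_total f g with h | h
      exacts [h, hmin ⟨hg, hgcl⟩ h]
    · have hfin : (M.E \ M.closure (A \ {e})).Finite := M.ground_finite.subset sdiff_subset
      obtain ⟨f, hf, hmax⟩ := hfin.exists_maximal
        ⟨e, hA.subset_ground heA, hA.indep.notMem_closure_sdiff_of_mem heA⟩
      have hmax' : ∀ g ∈ M.E, g ∉ M.closure (A \ {e}) → g ≤ f := fun g hg hgcl => by
        rcases le_total f g with h | h
        exacts [hmax ⟨hg, hgcl⟩ h, h]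
      refine ⟨f, hf.1, hf.2, ?_, Or.inr ⟨fun g hg => ?_, hmax'⟩⟩
      · by_contra! hle
        exact hep ((mem_IA_iff_of_isBase hA).mpr
          ⟨heA, fun g hg hgcl => (hmax' g hg hgcl).trans hle⟩)
      · by_contra h
        exact hne ⟨g, hg, h⟩
  have hfA := notMem_of_notMem_closure_sdiff_singleton hA hfcl hef.ne'
  have hB := isBase_exchange_of_notMem_closure hA hfE hef.ne' hfcl
  have hBf : insert f (A \ {e}) \ {f} = A \ {e} := insert_sdiff_self_of_notMem fun h => hfA h.1
  have hBA : insert e (insert f (A \ {e}) \ {f}) = A := by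
    rw [hBf, insert_sdiff_singleton, insert_eq_of_mem heA]
  have hecl : e ∉ M.closure (A \ {e}) := hA.indep.notMem_closure_sdiff_of_mem heA
  have hforth : ∀ {a g}, a ∈ A → a ≠ e → g ∉ M.closure (insert f (A \ {e}) \ {a}) →
      g ∉ M.closure (A \ {a}) ∨ f ∉ M.closure (A \ {a}) ∧ g ∉ M.closure (A \ {e}) :=
    fun ha hae hg => notMem_closure_of_exchange hA heA hef.ne' hfcl ha hae hg
  have hback : ∀ {a g}, a ∈ A → a ≠ e → g ∉ M.closure (A \ {a}) →
      g ∉ M.closure (insert f (A \ {e}) \ {a}) ∨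
        f ∉ M.closure (A \ {a}) ∧ g ∉ M.closure (A \ {e}) := by
    intro a g ha hae hg
    have haf : a ≠ f := fun h => hfA (h ▸ ha)
    -- The exchange is reversible, so the lemma applies to the new basis with `e` and `f` swapped;
    -- `hforth` then converts its condition on `e` into one on `f`.
    have := notMem_closure_of_exchange (f := e) (e := f) (a := a) (g := g) hB (mem_insert _ _)
      hef.ne (by rwa [hBf]) (Or.inr ⟨ha, hae⟩) haf (by rwa [hBA])
    rw [hBf] at this
    refine this.imp_right fun h => ⟨?_, h.2⟩
    rcases hforth ha hae h.1 with h' | h'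
    · exact absurd (M.subset_closure (A \ {a}) (sdiff_subset.trans hA.subset_ground)
        ⟨heA, hae.symm⟩) h'
    · exact h'.1
  refine ⟨f, hfA, hB, ?_, ?_, ?_⟩
  · ext g
    constructor
    · intro hg
      obtain ⟨⟨hgE, hgB⟩, hgact⟩ := (mem_EA_iff_of_isBase hB).mp hg
      have hgf : g ≠ f := fun h => hgB (Or.inl h)
      have hlt : g ∉ M.closure (A \ {e}) → f < g := fun h =>
        hgact f (mem_insert _ _) (by rwa [hBf])
      have hge : g ≠ e := by
        rintro rfl
        exact (hlt hecl).not_gt hef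
      refine ⟨(mem_EA_iff_of_isBase hA).mpr
        ⟨⟨hgE, fun h => hgB (Or.inr ⟨h, hge⟩)⟩, fun a ha hag => ?_⟩, hgf⟩
      by_cases hae : a = e
      · subst hae
        exact hef.trans (hlt hag)
      rcases hback ha hae hag with h | ⟨h, h'⟩
      · exact hgact a (Or.inr ⟨ha, hae⟩) h
      rcases hf with ⟨hfact, -⟩ | ⟨-, hmax⟩
      · exact (((mem_EA_iff_of_isBase hA).mp hfact).2 a ha h).trans (hlt h')
      · exact absurd (hmax g hgE h') (not_le.mpr (hlt h'))
    · rintro ⟨hg, hgf : g ≠ f⟩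
      obtain ⟨⟨hgE, hgA⟩, hgact⟩ := (mem_EA_iff_of_isBase hA).mp hg
      refine (mem_EA_iff_of_isBase hB).mpr ⟨⟨hgE, ?_⟩, ?_⟩
      · rintro (h | h)
        exacts [hgf h, hgA h.1]
      have hlt : g ∉ M.closure (A \ {e}) → f ∈ EA M A ∧ f < g := fun h => by
        rcases hf with ⟨hfact, hmin⟩ | ⟨hno, -⟩
        · exact ⟨hfact, lt_of_le_of_ne (hmin g hg h) hgf.symm⟩
        · exact absurd (hno g hg) h
      rintro a (rfl | ⟨ha, hae⟩) hag
      · rw [hBf] at hag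
        exact (hlt hag).2
      · rcases hforth ha hae hag with h | ⟨h, h'⟩
        · exact hgact a ha h
        · exact (((mem_EA_iff_of_isBase hA).mp (hlt h').1).2 a ha h).trans (hlt h').2
  · intro y hy
    have hye : y ≠ e := fun h => hep (h ▸ hy)
    obtain ⟨hyA, hyact⟩ := (mem_IA_iff_of_isBase hA).mp hy
    refine (mem_IA_iff_of_isBase hB).mpr ⟨Or.inr ⟨hyA, hye⟩, fun g hg hgy => ?_⟩
    rcases hforth hyA hye hgy with h | ⟨h, h'⟩
    · exact hyact g hg h
    rcases hf with ⟨hfact, -⟩ | ⟨-, hmax⟩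
    -- An externally active `f` and an internally active `y` cannot form an exchange pair of `A`:
    -- each would have to be the larger.
    · exact absurd (hyact f hfE h) (not_le.mpr (((mem_EA_iff_of_isBase hA).mp hfact).2 y hyA h))
    · exact (hmax g hg h').trans (hyact f hfE h)
  · refine eq_empty_of_forall_notMem ?_
    rintro x ⟨⟨hxB, hxp⟩, ⟨-, hxA⟩, hxE⟩
    -- Only `f` could violate the order. It is either externally active for `A`, or the maximum of
    -- its own fundamental cocircuit for the new basis, which is that of `e` for `A`.
    obtain rfl : x = f := hxB.resolve_right fun h => hxA h.1
    rcases hf with ⟨hfact, -⟩ | ⟨-, hmax⟩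
    · exact hxE hfact
    · exact hxp ((mem_IA_iff_of_isBase hB).mpr ⟨hxB, by rwa [hBf]⟩)


end Activities

/-! ### A shelling criterion through candidate restriction sets -/

section Shellings

variable {ι V : Type*} {Δ : Set (Set V)} {F R : ι → Set V} {r : ι → ι → Prop}

theorem isRestrictionSet_of_forall [IsLinearOrder ι r] (hRF : ∀ k, R k ⊆ F k)
    (hadj : ∀ k, ∀ v ∈ R k, ∃ j, r j k ∧ F k \ {v} ⊆ F j ∧ v ∉ F j)
    (hnew : ∀ i k, R k ⊆ F i → r k i) (k : ι) : IsRestrictionSet F r k (R k) := by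
  refine ⟨hRF k, fun A hA => ⟨fun hRA i hik hne hAi => ?_, fun h v hv => ?_⟩⟩
  · exact hne (antisymm_of r hik (hnew i k (hRA.trans hAi)))
  · obtain ⟨j, hjk, hsub, hvj⟩ := hadj k v hv
    by_contra hvA
    exact h j hjk (fun h => hvj (h ▸ hRF k hv))
      (fun x hx => hsub ⟨hA hx, fun h => hvA (h ▸ hx)⟩)

/-- A linear order on the maximal faces of a pure complex is a shelling order as soon as there is a
candidate family of restriction sets. -/
theorem isShellingOrder_of_forall [hr : IsLinearOrder ι r] (hΔ : Δ = {G | ∃ i, G ⊆ F i})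
    (hfin : ∀ i, (F i).Finite) (hpure : ∀ i j, (F i).encard = (F j).encard)
    (hRF : ∀ k, R k ⊆ F k)
    (hadj : ∀ k, ∀ v ∈ R k, ∃ j, r j k ∧ F k \ {v} ⊆ F j ∧ v ∉ F j)
    (hnew : ∀ i k, R k ⊆ F i → r k i) : IsShellingOrder Δ F r where
  isLinearOrder := hr
  injective i k h := antisymm_of r (hnew k i (h ▸ hRF i)) (hnew i k (h ▸ hRF k))
  range_eq := by
    have heq : ∀ i j, F i ⊆ F j → F i = F j := fun i j h =>
      -- Purity and finiteness rule out proper containments, so every `F i` is a maximal face.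
      (hfin i).eq_of_subset_of_encard_le h (hpure i j).ge
    ext G
    constructor
    · rintro ⟨i, rfl⟩
      refine ⟨hΔ ▸ ⟨i, subset_rfl⟩, fun G hG hle => ?_⟩
      obtain ⟨j, hj⟩ := hΔ ▸ hG
      exact (heq i j (hle.trans hj)) ▸ hj
    · rintro ⟨hG, hmax⟩
      obtain ⟨i, hi⟩ := hΔ ▸ hG
      exact ⟨i, (hmax (show F i ∈ Δ from hΔ ▸ ⟨i, subset_rfl⟩) hi).antisymm hi⟩
  pure := hpure
  shell i k hik hne := by
    have hnot : ¬ R k ⊆ F i := fun h => hne (antisymm_of r hik (hnew i k h))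
    obtain ⟨v, hv, hvi⟩ := not_subset.mp hnot
    obtain ⟨j, hjk, hsub, hvj⟩ := hadj k v hv
    have heq : F j ∩ F k = F k \ {v} := by
      refine Subset.antisymm ?_ fun x hx => ⟨hsub hx, hx.1⟩
      rintro x ⟨hxj, hxk⟩
      exact ⟨hxk, fun h => hvj (h ▸ hxj)⟩
    refine ⟨j, hjk, fun h => hvj (h ▸ hRF k hv), v, hRF k hv, ?_, heq⟩
    rw [heq]
    rintro x ⟨hxi, hxk⟩
    exact ⟨hxk, fun h => hvi (h ▸ hxi)⟩

/-- Each restriction set is itself a new face, hence contains the other. This lets the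
`h`-polynomial be computed from any given family of restriction sets. -/
theorem IsRestrictionSet.eq {k : ι} {S T : Set V} (hS : IsRestrictionSet F r k S)
    (hT : IsRestrictionSet F r k T) : S = T :=
  ((hS.2 T hT.1).mpr ((hT.2 T hT.1).mp subset_rfl)).antisymm
    ((hT.2 S hS.1).mpr ((hS.2 S hS.1).mp subset_rfl))

end Shellings

/-! ### Bookkeeping for the sets `x_S y_U z_T` -/

section Vertices

variable {α : Type*} {S U T : Set α} {e : α}

@[simp] theorem x_mem_xyz : Vertex.x e ∈ xyz S U T ↔ e ∈ S := by simp [xyz]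

@[simp] theorem y_mem_xyz : Vertex.y e ∈ xyz S U T ↔ e ∈ U := by simp [xyz]

@[simp] theorem z_mem_xyz : Vertex.z e ∈ xyz S U T ↔ e ∈ T := by simp [xyz]

@[simp] theorem suppY_xyz : suppY (xyz S U T) = U := by ext; simp [suppY]

@[simp] theorem suppZ_xyz : suppZ (xyz S U T) = T := by ext; simp [suppZ]

theorem xyz_subset_xyz {S' U' T' : Set α} :
    xyz S U T ⊆ xyz S' U' T' ↔ S ⊆ S' ∧ U ⊆ U' ∧ T ⊆ T' := by
  refine ⟨fun h => ⟨fun e he => ?_, fun e he => ?_, fun e he => ?_⟩, fun ⟨h₁, h₂, h₃⟩ => ?_⟩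
  · simpa using h (x_mem_xyz.mpr he)
  · simpa using h (y_mem_xyz.mpr he)
  · simpa using h (z_mem_xyz.mpr he)
  · exact union_subset_union (union_subset_union (image_mono h₁) (image_mono h₂)) (image_mono h₃)

theorem encard_xyz : (xyz S U T).encard = S.encard + U.encard + T.encard := by
  have hx : Function.Injective (Vertex.x : α → Vertex α) := fun _ _ h => by simpa using h
  have hy : Function.Injective (Vertex.y : α → Vertex α) := fun _ _ h => by simpa using h
  have hz : Function.Injective (Vertex.z : α → Vertex α) := fun _ _ h => by simpa using h
  rw [xyz, encard_union_eq, encard_union_eq, hx.encard_image, hy.encard_image, hz.encard_image]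
  · rw [disjoint_left]
    rintro _ ⟨a, -, rfl⟩ ⟨b, -, h⟩
    cases h
  · rw [disjoint_left]
    rintro _ (⟨a, -, rfl⟩ | ⟨a, -, rfl⟩) ⟨b, -, h⟩ <;> cases h

end Vertices

/-! ### The facets, their restriction sets and the shelling -/

section Complex

variable {α : Type*} [LinearOrder α] {M : Matroid α} [M.Finite] {I J : IndepSet M} {A Y : Set α}

theorem relatedTo_relatedBase (I : IndepSet M) : RelatedTo M I (relatedBase M I) :=
  (exists_relatedTo M I.2).choose_spec

theorem isBase_relatedBase (I : IndepSet M) : M.IsBase (relatedBase M I) :=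
  (relatedTo_relatedBase I).1

theorem relatedBase_eq (hA : M.IsBase A) (hY : Y ⊆ IA M A) (hI : (I : Set α) = A \ Y) :
    relatedBase M I = A :=
  relatedTo_unique M (relatedTo_relatedBase I) ⟨hA, Y, hY, hI⟩

theorem removed_eq (hA : M.IsBase A) (hY : Y ⊆ IA M A) (hI : (I : Set α) = A \ Y) :
    removed M I = Y := by
  rw [removed, relatedBase_eq hA hY hI, hI, sdiff_sdiff_cancel_left fun y hy => (hY hy).1]

theorem removed_subset_IA (I : IndepSet M) : removed M I ⊆ IA M (relatedBase M I) := by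
  obtain ⟨hA, Y, hY, hI⟩ := relatedTo_relatedBase I
  rwa [removed_eq hA hY hI]

theorem coe_eq_relatedBase_sdiff_removed (I : IndepSet M) :
    (I : Set α) = relatedBase M I \ removed M I := by
  obtain ⟨hA, Y, hY, hI⟩ := relatedTo_relatedBase I
  rwa [removed_eq hA hY hI]

theorem IP_coe (I : IndepSet M) : IP M (I : Set α) = IP M (relatedBase M I) := by
  conv_lhs => rw [coe_eq_relatedBase_sdiff_removed I]
  exact IP_sdiff_of_subset_IA (isBase_relatedBase I) (removed_subset_IA I)

/-- Deleting `Y` from `A` moves `Y` into the externally passive set, so the `x`-part depends on `A`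
only. -/
theorem augFacet_eq (hA : M.IsBase A) (hY : Y ⊆ IA M A) (hI : (I : Set α) = A \ Y) :
    augFacet M I = xyz (M.E \ EA M A) Y (A \ Y ∪ EA M A) := by
  rw [augFacet, removed_eq hA hY hI, hI, EA_sdiff_of_subset_IA hA hY, EP_sdiff_of_subset_IA hA hY,
    ← union_EP_eq hA, union_comm (EP M A), ← union_assoc,
    sdiff_union_of_subset fun y hy => (hY hy).1]

theorem augFacet_eq' (I : IndepSet M) : augFacet M I =
    xyz (M.E \ EA M (relatedBase M I)) (removed M I)
      (relatedBase M I \ removed M I ∪ EA M (relatedBase M I)) :=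
  augFacet_eq (isBase_relatedBase I) (removed_subset_IA I) (coe_eq_relatedBase_sdiff_removed I)

theorem encard_augFacet (I : IndepSet M) : (augFacet M I).encard = M.E.encard + M.eRank := by
  have hA := isBase_relatedBase I
  have hY := removed_subset_IA I
  rw [augFacet_eq', encard_xyz, encard_union_eq, ← hA.encard_eq_eRank]
  · rw [← encard_sdiff_add_encard_of_subset (show EA M (relatedBase M I) ⊆ M.E from
        fun x hx => hx.1.1),
      ← encard_sdiff_add_encard_of_subset (show removed M I ⊆ relatedBase M I from sdiff_subset)]
    abel
  · exact disjoint_left.mpr fun x hx h => h.1.2 hx.1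

theorem finite_augFacet (I : IndepSet M) : (augFacet M I).Finite := by
  rw [← encard_lt_top_iff, encard_augFacet, ← (isBase_relatedBase I).encard_eq_eRank]
  exact WithTop.add_lt_top.mpr ⟨M.ground_finite.encard_lt_top,
    (M.ground_finite.subset (isBase_relatedBase I).subset_ground).encard_lt_top⟩

/-- The restriction set `y_{Y_I} z_{IP(A)}`, where `A` is the basis related to `I`. -/
noncomputable def restrictionSet (M : Matroid α) [M.Finite] (I : IndepSet M) : Set (Vertex α) :=
  xyz ∅ (removed M I) (IP M (relatedBase M I))

theorem restrictionSet_subset_augFacet (I : IndepSet M) : restrictionSet M I ⊆ augFacet M I := by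
  rw [augFacet_eq', restrictionSet, xyz_subset_xyz]
  exact ⟨empty_subset _, subset_rfl, fun e he =>
    Or.inl ⟨he.1, fun h => he.2 (removed_subset_IA I h)⟩⟩

/-- The `z`-part puts `IP(A)` inside `B ∪ EA(B)`, hence off `EP(B)`; when the bases agree, the
`y`-part gives `Y_I ⊆ Y_J`. -/
theorem flippedLE_of_restrictionSet_subset (h : restrictionSet M I ⊆ augFacet M J) :
    FlippedLE M I J := by
  rw [augFacet_eq', restrictionSet, xyz_subset_xyz] at h
  obtain ⟨-, hY, hP⟩ := h
  by_cases hAB : relatedBase M I = relatedBase M J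
  · refine Or.inr ⟨hAB, ?_⟩
    rw [coe_eq_relatedBase_sdiff_removed I, coe_eq_relatedBase_sdiff_removed J, hAB]
    exact sdiff_subset_sdiff_right hY
  · refine Or.inl ⟨hAB, eq_empty_of_forall_notMem fun e he => ?_⟩
    rcases hP he.1 with h | h
    exacts [he.2.1.2 h.1, he.2.2 h]

theorem exists_augFacet_adjacent (I : IndepSet M) {v : Vertex α} (hv : v ∈ restrictionSet M I) :
    ∃ J, FlippedLE M J I ∧ augFacet M I \ {v} ⊆ augFacet M J ∧ v ∉ augFacet M J := by
  obtain ⟨hA, Y, hY, hI⟩ := relatedTo_relatedBase I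
  rw [restrictionSet, removed_eq hA hY hI] at hv
  rw [augFacet_eq hA hY hI]
  generalize hAI : relatedBase M I = A at *
  rcases v with e | e | e
  · simp at hv
  · rw [y_mem_xyz] at hv
    have hY' : Y \ {e} ⊆ IA M A := sdiff_subset.trans hY
    obtain ⟨J, hJ⟩ : ∃ J : IndepSet M, (J : Set α) = A \ (Y \ {e}) :=
      ⟨⟨_, hA.indep.subset sdiff_subset⟩, rfl⟩
    refine ⟨J, Or.inr ⟨(relatedBase_eq hA hY' hJ).trans hAI.symm, ?_⟩, ?_⟩
    · rw [hI, hJ]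
      exact sdiff_subset_sdiff_right sdiff_subset
    rw [augFacet_eq hA hY' hJ]
    constructor
    · rintro (x | x | x) <;> simp; tauto
    · simp
  · rw [z_mem_xyz] at hv
    obtain ⟨f, hfA, hB, hEA, hIA, hle⟩ := exists_exchange_of_mem_IP hA hv
    have hY' := hY.trans hIA
    obtain ⟨J, hJ⟩ : ∃ J : IndepSet M, (J : Set α) = insert f (A \ {e}) \ Y :=
      ⟨⟨_, hB.indep.subset sdiff_subset⟩, rfl⟩
    have hJB := relatedBase_eq hB hY' hJ
    have hfY : f ∉ Y := fun h => hfA (hY h).1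
    have hfe : e ≠ f := fun h => hfA (h ▸ hv.1)
    refine ⟨J, Or.inl ⟨?_, ?_⟩, ?_⟩
    · rw [hJB, hAI]
      exact fun h => hfA (h ▸ mem_insert f _)
    · rwa [hJB, hAI]
    rw [augFacet_eq hB hY' hJ, hEA]
    constructor
    · rintro (x | x | x)
      · simp; tauto
      · simp
      · by_cases hxf : x = f
        · subst hxf; simp [hfY]
        · simp; tauto
    · have heEA : e ∉ EA M A := fun h => h.1.2 hv.1
      simp [hfe, heEA]

theorem isShellingOrder_augComplex {prec : IndepSet M → IndepSet M → Prop}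
    (h : IsLinearExtension (FlippedLE M) prec) :
    IsShellingOrder (augComplex M) (augFacet M) prec :=
  have := h.isLinearOrder
  isShellingOrder_of_forall (R := restrictionSet M) rfl finite_augFacet
    (fun I J => by rw [encard_augFacet, encard_augFacet]) restrictionSet_subset_augFacet
    (fun I _ hv => (exists_augFacet_adjacent I hv).imp fun J hJ => ⟨h.extend J I hJ.1, hJ.2⟩)
    fun J I hIJ => h.extend I J (flippedLE_of_restrictionSet_subset hIJ)

theorem isRestrictionSet_restrictionSet {prec : IndepSet M → IndepSet M → Prop}
    (h : IsLinearExtension (FlippedLE M) prec) (I : IndepSet M) :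
    IsRestrictionSet (augFacet M) prec I (restrictionSet M I) :=
  have := h.isLinearOrder
  isRestrictionSet_of_forall restrictionSet_subset_augFacet
    (fun I _ hv => (exists_augFacet_adjacent I hv).imp fun J hJ => ⟨h.extend J I hJ.1, hJ.2⟩)
    (fun J I hIJ => h.extend I J (flippedLE_of_restrictionSet_subset hIJ)) I

theorem bivariateH_eq {prec : IndepSet M → IndepSet M → Prop}
    (h : IsLinearExtension (FlippedLE M) prec) {R : IndepSet M → Set (Vertex α)}
    (hR : ∀ I, IsRestrictionSet (augFacet M) prec I (R I)) (d : ℕ) :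
    bivariateH d R = ∑ᶠ I : IndepSet M, qPow (-((removed M I).ncard : ℤ)) *
      tPow ((d : ℤ) - ((IP M (I : Set α)).ncard : ℤ)) := by
  refine finsum_congr fun I => ?_
  rw [(hR I).eq (isRestrictionSet_restrictionSet h I), restrictionSet, suppY_xyz, suppZ_xyz, IP_coe]

end Complex

/-! ### The Tutte polynomial evaluation -/

section Tutte

theorem qPow_neg_natCast (k : ℕ) : qPow (-(k : ℤ)) = qPow (-1) ^ k := by
  rw [qPow, qPow, LaurentPolynomial.T_pow, mul_neg_one]

theorem tPow_add (a b : ℤ) : tPow (a + b) = tPow a * tPow b := by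
  rw [tPow, LaurentPolynomial.T_add, map_mul, tPow, tPow]

theorem tPow_natCast (k : ℕ) : tPow (k : ℤ) = tPow 1 ^ k := by
  rw [tPow, tPow, ← map_pow, LaurentPolynomial.T_pow, mul_one]

variable {α : Type*} {M : Matroid α}

instance isBaseFinite (M : Matroid α) [M.Finite] : Finite {B : Set α // M.IsBase B} :=
  (M.ground_finite.finite_subsets.subset fun _ hB => hB.subset_ground :
    {B : Set α | M.IsBase B}.Finite).to_subtype

theorem ncard_eq_rank {B : Set α} (hB : M.IsBase B) : B.ncard = rank M := by
  rw [rank, ← hB.encard_eq_eRank, ncard_def]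

theorem rk_eq_ncard {I : Set α} (hI : M.Indep I) : rk M I = I.ncard := by
  rw [rk, hI.eRk_eq_encard, ncard_def]

theorem rk_lt_ncard [M.Finite] {S : Set α} (hS : M.Dep S) : rk M S < S.ncard := by
  have hfin := M.ground_finite.subset hS.subset_ground
  have h := M.eRk_lt_encard_of_dep_of_finite hfin hS
  rw [← hfin.cast_ncard_eq, ← ENat.natCast_toNat h.ne_top] at h
  exact_mod_cast h

/-- At `y = 1` a dependent set contributes a positive power of `0`, while an independent set has
nullity `0` and contributes `0 ^ 0 = 1`. -/
theorem tutteEval_one (M : Matroid α) [M.Finite] (a : Laurent2) :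
    tutteEval M a 1 = ∑ᶠ I : IndepSet M, (a - 1) ^ (rank M - (I : Set α).ncard) := by
  classical
  have := Fintype.ofFinite (IndepSet M)
  rw [finsum_eq_sum_of_fintype, tutteEval, tutte, map_sum]
  symm
  refine Finset.sum_of_injOn
    (fun I : IndepSet M => (M.ground_finite.subset I.2.subset_ground).toFinset) ?_ ?_ ?_ ?_
  · intro I _ J _ h
    exact Subtype.ext (by simpa using h)
  · intro I _
    simpa using I.2.subset_ground
  · intro S hS hSI
    have hSE : (S : Set α) ⊆ M.E := by simpa using hS
    have hdep : M.Dep (S : Set α) := by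
      rw [← M.not_indep_iff]
      exact fun h => hSI ⟨⟨S, h⟩, by simp, by simp⟩
    have := rk_lt_ncard hdep
    rw [ncard_coe_finset] at this
    simp [zero_pow (Nat.sub_ne_zero_of_lt this)]
  · intro I _
    simp [rk_eq_ncard I.2, ← ncard_eq_toFinset_card]

variable [LinearOrder α] [M.Finite]

/-- Summation over the independent sets, grouped by the related basis. -/
theorem finsum_indepSet_eq {R : Type*} [CommSemiring R] (w : Set α → R) (u : R) :
    ∑ᶠ I : IndepSet M, w (relatedBase M I) * u ^ (removed M I).ncard =
      ∑ᶠ B : {B : Set α // M.IsBase B}, w B * (u + 1) ^ (IA M (B : Set α)).ncard := by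
  classical
  have := Fintype.ofFinite (IndepSet M)
  have := Fintype.ofFinite {B : Set α // M.IsBase B}
  rw [finsum_eq_sum_of_fintype, finsum_eq_sum_of_fintype,
    ← Finset.sum_fiberwise (g := fun I : IndepSet M =>
      (⟨relatedBase M I, isBase_relatedBase I⟩ : {B : Set α // M.IsBase B}))]
  refine Finset.sum_congr rfl fun ⟨B, hB⟩ _ => ?_
  have hfinB : (IA M B).Finite :=
    M.ground_finite.subset fun x hx => hB.subset_ground hx.1
  have hfin : ∀ I : IndepSet M, (removed M I).Finite := fun I =>
    M.ground_finite.subset (sdiff_subset.trans (isBase_relatedBase I).subset_ground)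
  have hpow : (u + 1) ^ (IA M B).ncard = ∑ Y ∈ hfinB.toFinset.powerset, u ^ Y.card := by
    rw [ncard_eq_toFinset_card _ hfinB, ← Finset.sum_pow_mul_eq_add_pow]
    simp
  rw [hpow, Finset.mul_sum]
  refine Finset.sum_bij (fun I _ => (hfin I).toFinset) ?_ ?_ ?_ ?_
  · intro I hI
    have hI : relatedBase M I = B := by simpa using hI
    simpa [hI] using removed_subset_IA I
  · intro I hI J hJ h
    have hI : relatedBase M I = B := by simpa using hI
    have hJ : relatedBase M J = B := by simpa using hJ
    have h : removed M I = removed M J := by simpa using h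
    apply Subtype.ext
    rw [coe_eq_relatedBase_sdiff_removed I, coe_eq_relatedBase_sdiff_removed J, hI, hJ, h]
  · intro Y hY
    have hY : (Y : Set α) ⊆ IA M B := by simpa using hY
    obtain ⟨I, hI⟩ : ∃ I : IndepSet M, (I : Set α) = B \ Y :=
      ⟨⟨_, hB.indep.subset sdiff_subset⟩, rfl⟩
    exact ⟨I, by simpa using relatedBase_eq hB hY hI, by simp [removed_eq hB hY hI]⟩
  · intro I hI
    have hI : relatedBase M I = B := by simpa using hI
    rw [hI, ncard_eq_toFinset_card _ (hfin I)]

theorem rank_sub_ncard (I : IndepSet M) : rank M - (I : Set α).ncard = (removed M I).ncard := by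
  have hA := isBase_relatedBase I
  have hfin := M.ground_finite.subset hA.subset_ground
  have hsub : removed M I ⊆ relatedBase M I := sdiff_subset
  rw [coe_eq_relatedBase_sdiff_removed I, ← ncard_eq_rank hA,
    ← ncard_sdiff_add_ncard_of_subset hsub hfin, Nat.add_sub_cancel_left]

theorem finsum_indepSet_eq_tutteEval (M : Matroid α) [M.Finite] :
    (∑ᶠ I : IndepSet M, qPow (-((removed M I).ncard : ℤ)) *
      tPow ((M.E.ncard : ℤ) + (rank M : ℤ) - ((IP M (I : Set α)).ncard : ℤ))) =
      tPow (M.E.ncard : ℤ) * tutteEval M ((qPow (-1) + 1) * tPow 1) 1 := by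
  have hleft : ∀ I : IndepSet M, qPow (-((removed M I).ncard : ℤ)) *
      tPow ((M.E.ncard : ℤ) + (rank M : ℤ) - ((IP M (I : Set α)).ncard : ℤ)) =
      tPow (M.E.ncard : ℤ) * tPow 1 ^ (IA M (relatedBase M I)).ncard *
        qPow (-1) ^ (removed M I).ncard := fun I => by
    have hA := isBase_relatedBase I
    have hsub : IA M (relatedBase M I) ⊆ relatedBase M I := fun x hx => hx.1
    have hcard := ncard_sdiff_add_ncard_of_subset hsub
      (M.ground_finite.subset hA.subset_ground)
    rw [ncard_eq_rank hA] at hcard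
    rw [qPow_neg_natCast, IP_coe, ← tPow_natCast, ← tPow_add, mul_comm]
    congr 2
    simp only [IP]
    omega
  have hright : ∀ I : IndepSet M, ((qPow (-1) + 1) * tPow 1 - 1) ^ (rank M - (I : Set α).ncard) =
      1 * ((qPow (-1) + 1) * tPow 1 - 1) ^ (removed M I).ncard := fun I => by
    rw [rank_sub_ncard, one_mul]
  -- The grouping lemma is used on both sides: with weight `t^(n + |IA(B)|)` on the left, since `r -
  -- |IP(B)| = |IA(B)|`, and with weight `1` on the right.
  rw [finsum_congr hleft, tutteEval_one, finsum_congr hright,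
    finsum_indepSet_eq (fun B => tPow (M.E.ncard : ℤ) * tPow 1 ^ (IA M B).ncard),
    finsum_indepSet_eq (fun _ => 1), mul_finsum]
  refine finsum_congr fun B => ?_
  rw [sub_add_cancel, mul_pow]
  ring

end Tutte

end AugExt

theorem mainTheorem7 {α : Type*} [LinearOrder α] (M : Matroid α) [M.Finite] :
    -- every linear extension of the flipped order is a shelling order, with these restriction
    -- sets, and its bivariate h-polynomial is the sum over independent sets
    (∀ prec : AugExt.IndepSet M → AugExt.IndepSet M → Prop,
      AugExt.IsLinearExtension (AugExt.FlippedLE M) prec →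
        AugExt.IsShellingOrder (AugExt.augComplex M) (AugExt.augFacet M) prec ∧
        (∀ (I : AugExt.IndepSet M) (A Y : Set α),
          M.IsBase A → Y ⊆ AugExt.IA M A → (I : Set α) = A \ Y →
            AugExt.IsRestrictionSet (AugExt.augFacet M) prec I
              (AugExt.xyz ∅ Y (AugExt.IP M A))) ∧
        (∀ R : AugExt.IndepSet M → Set (AugExt.Vertex α),
          (∀ I, AugExt.IsRestrictionSet (AugExt.augFacet M) prec I (R I)) →
            AugExt.bivariateH (M.E.ncard + AugExt.rank M) R =
              ∑ᶠ I : AugExt.IndepSet M,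
                AugExt.qPow (-((AugExt.removed M I).ncard : ℤ)) *
                  AugExt.tPow ((M.E.ncard : ℤ) + (AugExt.rank M : ℤ) -
                    ((AugExt.IP M (I : Set α)).ncard : ℤ)))) ∧
    -- and that sum is an evaluation of the Tutte polynomial
    (∑ᶠ I : AugExt.IndepSet M,
        AugExt.qPow (-((AugExt.removed M I).ncard : ℤ)) *
          AugExt.tPow ((M.E.ncard : ℤ) + (AugExt.rank M : ℤ) -
            ((AugExt.IP M (I : Set α)).ncard : ℤ))) =
      AugExt.tPow (M.E.ncard : ℤ) *
        AugExt.tutteEval M ((AugExt.qPow (-1) + 1) * AugExt.tPow 1) 1 := by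
  refine ⟨fun prec h => ⟨AugExt.isShellingOrder_augComplex h, fun I A Y hA hY hI => ?_,
    fun R hR => ?_⟩, AugExt.finsum_indepSet_eq_tutteEval M⟩
  · have hR := AugExt.isRestrictionSet_restrictionSet h I
    rwa [AugExt.restrictionSet, AugExt.removed_eq hA hY hI, AugExt.relatedBase_eq hA hY hI] at hR
  · rw [AugExt.bivariateH_eq h hR]
    simp only [Nat.cast_add]
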